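/- Let $f_c\ge 0$ be an integer and let $\varepsilon^{(1)}_k,\varepsilon^{(2)}_k$, $k\in\{-f_c,\dots,f_c\}$, be $2(2f_c+1)$ independent real random variables, each with the standard normal distribution $\mathcal N(0,1)$. Put $\varepsilon_k=\varepsilon^{(1)}_k+\mathrm i\,\varepsilon^{(2)}_k$ and $$Z(t)=\sum_{k=-f_c}^{f_c}\varepsilon_k\,e^{2\pi\mathrm i kt},\qquad t\in[0,1].$$ Then, for every real $u>\sqrt2$, $$\mathbb P\Big\{\sup_{t\in[0,1]}|Z(t)|>u\Big\}\le 4\left(\exp\Big(-\frac{u^2}{2(2f_c+1)}\Big)+\sqrt{\frac{f_c(f_c+1)}{3}}\,\exp\Big(-\frac{u^2}{4(2f_c+1)}\Big)\right).$$ -/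

import Mathlib

noncomputable section

/-- The set of frequencies `{-f_c, …, f_c}`. -/
abbrev Freq (fc : ℕ) : Type := {k : ℤ // k ∈ Finset.Icc (-(fc : ℤ)) (fc : ℤ)}

/-- The trigonometric function `t ↦ exp (2 π i k t)`. -/
def trigFun (k : ℤ) (t : ℝ) : ℂ :=
  Complex.exp (2 * (Real.pi : ℂ) * Complex.I * (k : ℂ) * (t : ℂ))

/-- The trigonometric polynomial `∑_{|k| ≤ f_c} ε_k exp (2 π i k t)`. -/
def trigPoly {fc : ℕ} (ε : Freq fc → ℂ) (t : ℝ) : ℂ :=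
  ∑ k : Freq fc, ε k * trigFun (k : ℤ) t

end

open MeasureTheory ProbabilityTheory
open scoped ENNReal NNReal

/-! ### Linear forms in independent standard Gaussians -/

section GaussianLinearForms

variable {Ω ι κ : Type*} [MeasurableSpace Ω] {P : Measure Ω} [Fintype ι] {W : ι → Ω → ℝ}

/-! Write `Z = X + iY`, `S = |Z|²`, `N = 2 f_c + 1`. For fixed `t`, the variables `X, Y, X', Y'` are
linear forms in the coefficients with orthogonal coefficient vectors (this uses `∑ k = 0`), hence
independent Gaussians; `X, Y` have variance `N`, and `X', Y'` have variance `q = (2π)² f_c (f_c + 1)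
N / 3`.

Let `G` be a `C¹` ramp rising from `0` at `α` to `1` at `u²`, with `h = G'`. The function `G(S(t))`
is 1-periodic and equals `1` wherever `|Z| > u`, so if the supremum exceeds `u`, then `1 ≤ G(S(0)) +
½ ∫₀¹ |(G ∘ S)'|` (`le_add_half_integral_abs_deriv`). By Markov's inequality it remains to bound the
expectation of the right side. The first term costs at most `P(S(0) > α) ≤ exp(-α/2N)`. In the
second, `½ |(G ∘ S)'| = h(S) |XX' + YY'|`. Averaging over `(X', Y')` gives at most `u √q · h(S)`
(`lintegral_mul_abs_le_of_indepFun`), and since `S` is exponentially distributed, `E h(S) ≤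
exp(-α/2N) / 2N` (`lintegral_deriv_sq_add_sq_le`).

With `α = u² - N/2` and `x = u/√N`, the total is `exp(1/4 - x²/2) (1 + π x c)`, where `c = √(f_c
(f_c + 1)/3)`. An elementary inequality (`exp_mul_one_add_le`) finishes; for `u² < N` the claimed
bound exceeds `1`. -/

theorem hasGaussianLaw_linearForms [Fintype κ]
    (hW : ∀ i, HasLaw (W i) (gaussianReal 0 1) P) (hind : iIndepFun W P) (a : κ → ι → ℝ) :
    HasGaussianLaw (fun ω j => ∑ i, a j i * W i ω) P := by
  have h := iIndepFun.hasGaussianLaw (fun i => (hW i).hasGaussianLaw) hind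
  let L : (ι → ℝ) →L[ℝ] (κ → ℝ) :=
    ContinuousLinearMap.pi fun j => ∑ i, a j i • ContinuousLinearMap.proj (R := ℝ) i
  have hL : (fun ω j => ∑ i, a j i * W i ω) = fun ω => L (W · ω) := by
    ext ω j
    simp [L]
  rw [hL]
  exact h.map_fun L

theorem memLp_two_linearForm (hW : ∀ i, HasLaw (W i) (gaussianReal 0 1) P) (a : ι → ℝ) :
    MemLp (fun ω => ∑ i, a i * W i ω) 2 P :=
  memLp_finsetSum _ fun i _ => ((hW i).hasGaussianLaw.memLp_two).const_mul (a i)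

theorem integral_linearForm (hW : ∀ i, HasLaw (W i) (gaussianReal 0 1) P) (a : ι → ℝ) :
    ∫ ω, ∑ i, a i * W i ω ∂P = 0 := by
  rw [integral_finsetSum _ fun i _ => ((hW i).hasGaussianLaw.integrable).const_mul (a i)]
  refine Finset.sum_eq_zero fun i _ => ?_
  rw [integral_const_mul, (hW i).integral_eq, integral_id_gaussianReal, mul_zero]

theorem covariance_linearForm [IsProbabilityMeasure P]
    (hW : ∀ i, HasLaw (W i) (gaussianReal 0 1) P) (hind : iIndepFun W P) (a b : ι → ℝ) :
    cov[fun ω => ∑ i, a i * W i ω, fun ω => ∑ i, b i * W i ω; P] = ∑ i, a i * b i := by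
  classical
  have hm : ∀ i, MemLp (W i) 2 P := fun i => (hW i).hasGaussianLaw.memLp_two
  rw [covariance_fun_sum_left (fun i => (hm i).const_mul (a i)) (memLp_two_linearForm hW b)]
  refine Finset.sum_congr rfl fun i _ => ?_
  rw [covariance_fun_sum_right (fun j => (hm j).const_mul (b j)) ((hm i).const_mul (a i)),
    Finset.sum_eq_single i]
  · rw [covariance_const_mul_left, covariance_const_mul_right,
      covariance_self (hm i).aemeasurable, (hW i).variance_eq, variance_id_gaussianReal]
    simp
  · intro j _ hj
    rw [covariance_const_mul_left, covariance_const_mul_right,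
      (hind.indepFun hj.symm).covariance_eq_zero (hm i) (hm j)]
    simp
  · simp

theorem integral_linearForm_mul [IsProbabilityMeasure P]
    (hW : ∀ i, HasLaw (W i) (gaussianReal 0 1) P) (hind : iIndepFun W P) (a b : ι → ℝ) :
    ∫ ω, (∑ i, a i * W i ω) * (∑ i, b i * W i ω) ∂P = ∑ i, a i * b i := by
  have h := covariance_eq_sub (memLp_two_linearForm hW a) (memLp_two_linearForm hW b)
  rw [covariance_linearForm hW hind, integral_linearForm hW, zero_mul, sub_zero] at h
  exact h.symm

theorem map_linearForm_eq_gaussianReal [IsProbabilityMeasure P]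
    (hW : ∀ i, HasLaw (W i) (gaussianReal 0 1) P) (hind : iIndepFun W P) (a : ι → ℝ) :
    P.map (fun ω => ∑ i, a i * W i ω) = gaussianReal 0 (∑ i, a i ^ 2).toNNReal := by
  have h : HasGaussianLaw (fun ω => ∑ i, a i * W i ω) P :=
    (hasGaussianLaw_linearForms hW hind fun _ : Unit => a).map_fun
      (ContinuousLinearMap.proj (R := ℝ) ())
  rw [h.map_eq_gaussianReal, integral_linearForm hW, ← covariance_self h.aemeasurable,
    covariance_linearForm hW hind]
  simp_rw [sq]

/-- Linear forms in independent standard Gaussian variables with orthogonal coefficient vectors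
are independent. -/
theorem iIndepFun_linearForms [IsProbabilityMeasure P] [Fintype κ]
    (hW : ∀ i, HasLaw (W i) (gaussianReal 0 1) P) (hind : iIndepFun W P) (a : κ → ι → ℝ)
    (horth : ∀ j l, j ≠ l → ∑ i, a j i * a l i = 0) :
    iIndepFun (fun j ω => ∑ i, a j i * W i ω) P :=
  (hasGaussianLaw_linearForms hW hind a).iIndepFun_of_covariance_eq_zero fun j l hjl => by
    rw [covariance_linearForm hW hind, horth j l hjl]

end GaussianLinearForms

/-! ### The squared modulus of an isotropic planar Gaussian -/

section Rayleigh

/-- The product density depends only on the radius, so in polar coordinates the angle integrates out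
and leaves the Rayleigh density. -/
theorem lintegral_gaussian_prod_radial {v : ℝ≥0} (hv : v ≠ 0) {f : ℝ → ℝ≥0∞} (hf : Measurable f) :
    ∫⁻ p : ℝ × ℝ, f (p.1 ^ 2 + p.2 ^ 2) ∂((gaussianReal 0 v).prod (gaussianReal 0 v)) =
      ∫⁻ r in Set.Ioi (0 : ℝ),
        ENNReal.ofReal (r / v * Real.exp (-r ^ 2 / (2 * v))) * f (r ^ 2) := by
  have hv0 : (0 : ℝ) < v := by positivity
  rw [gaussianReal_of_var_ne_zero _ hv,
    prod_withDensity (measurable_gaussianPDF 0 v) (measurable_gaussianPDF 0 v),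
    lintegral_withDensity_eq_lintegral_mul _ (by fun_prop) (by fun_prop),
    ← Measure.volume_eq_prod, ← lintegral_comp_polarCoord_symm]
  have hpt : ∀ p ∈ polarCoord.target, ENNReal.ofReal p.1 •
      ((fun z : ℝ × ℝ => gaussianPDF 0 v z.1 * gaussianPDF 0 v z.2) *
        fun p : ℝ × ℝ => f (p.1 ^ 2 + p.2 ^ 2)) (polarCoord.symm p) =
      ENNReal.ofReal (p.1 / (2 * Real.pi * v) * Real.exp (-p.1 ^ 2 / (2 * v))) * f (p.1 ^ 2) := by
    rintro ⟨r, θ⟩ hp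
    have hr : 0 < r := by simpa using hp.1
    have hsq : (r * Real.cos θ) ^ 2 + (r * Real.sin θ) ^ 2 = r ^ 2 := by
      linear_combination r ^ 2 * Real.sin_sq_add_cos_sq θ
    simp only [polarCoord_symm_apply, Pi.mul_apply, hsq, smul_eq_mul]
    rw [← mul_assoc, gaussianPDF, gaussianPDF, ← ENNReal.ofReal_mul (gaussianPDFReal_nonneg _ _ _),
      ← ENNReal.ofReal_mul hr.le]
    congr 2
    simp only [gaussianPDFReal, sub_zero]
    have h1 : (√(2 * Real.pi * v))⁻¹ * (√(2 * Real.pi * v))⁻¹ = (2 * Real.pi * v)⁻¹ := by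
      rw [← mul_inv, Real.mul_self_sqrt (by positivity)]
    have h2 : Real.exp (-r ^ 2 / (2 * v)) = Real.exp (-(r * Real.cos θ) ^ 2 / (2 * v)) *
        Real.exp (-(r * Real.sin θ) ^ 2 / (2 * v)) := by
      rw [← Real.exp_add, ← hsq]
      congr 1
      ring
    rw [h2, div_eq_mul_inv r, ← h1]
    ring
  rw [setLIntegral_congr_fun polarCoord.open_target.measurableSet hpt, polarCoord_target,
    Measure.volume_eq_prod, setLIntegral_prod _ (by fun_prop)]
  refine setLIntegral_congr_fun measurableSet_Ioi fun r hr => ?_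
  have hr : 0 < r := hr
  simp only [lintegral_const, Measure.restrict_apply, MeasurableSet.univ, Set.univ_inter,
    Real.volume_Ioo]
  -- The angular interval `(-π, π)` has length `2π`, which cancels the normalising constant.
  rw [mul_right_comm, ← ENNReal.ofReal_mul (by positivity)]
  congr 2
  field_simp
  ring

variable {Ω : Type*} [MeasurableSpace Ω] {P : Measure Ω} [IsProbabilityMeasure P] {X Y : Ω → ℝ}
  {v : ℝ≥0}

theorem lintegral_radial_of_indepFun_gaussian (hv : v ≠ 0) (hX : HasLaw X (gaussianReal 0 v) P)
    (hY : HasLaw Y (gaussianReal 0 v) P) (hXY : IndepFun X Y P) {f : ℝ → ℝ≥0∞}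
    (hf : Measurable f) :
    ∫⁻ ω, f (X ω ^ 2 + Y ω ^ 2) ∂P = ∫⁻ r in Set.Ioi (0 : ℝ),
      ENNReal.ofReal (r / v * Real.exp (-r ^ 2 / (2 * v))) * f (r ^ 2) := by
  have hmap := (indepFun_iff_map_prod_eq_prod_map_map hX.aemeasurable hY.aemeasurable).1 hXY
  rw [hX.map_eq, hY.map_eq] at hmap
  rw [← lintegral_gaussian_prod_radial hv hf, ← hmap,
    lintegral_map' (by fun_prop) (hX.aemeasurable.prodMk hY.aemeasurable)]

/-- The Rayleigh density has the explicit primitive `-exp(-r²/2v)`, integrated here over `r > √α`.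
-/
theorem lintegral_indicator_sq_add_sq_le (hv : v ≠ 0) (hX : HasLaw X (gaussianReal 0 v) P)
    (hY : HasLaw Y (gaussianReal 0 v) P) (hXY : IndepFun X Y P) {α : ℝ} (hα : 0 ≤ α) :
    ∫⁻ ω, (Set.Ioi α).indicator 1 (X ω ^ 2 + Y ω ^ 2) ∂P ≤
      ENNReal.ofReal (Real.exp (-α / (2 * v))) := by
  have hv0 : (0 : ℝ) < v := by positivity
  rw [lintegral_radial_of_indepFun_gaussian hv hX hY hXY
    (measurable_one.indicator measurableSet_Ioi)]
  have hderiv : ∀ r : ℝ, HasDerivAt (fun r : ℝ => -Real.exp (-r ^ 2 / (2 * v)))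
      (r / v * Real.exp (-r ^ 2 / (2 * v))) r := by
    intro r
    have h := (((hasDerivAt_id r).pow 2).neg.div_const (2 * (v : ℝ))).exp.neg
    convert! h using 1
    simp
    field_simp
  have hlim : Filter.Tendsto (fun r : ℝ => -Real.exp (-r ^ 2 / (2 * v))) Filter.atTop
      (nhds (-0)) := by
    refine (Real.tendsto_exp_atBot.comp ?_).neg
    refine Filter.Tendsto.atBot_div_const (by positivity) ?_
    exact Filter.tendsto_neg_atTop_atBot.comp (Filter.tendsto_pow_atTop two_ne_zero)
  have hnn : ∀ r ∈ Set.Ioi √α, 0 ≤ r / v * Real.exp (-r ^ 2 / (2 * v)) := fun r hr => by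
    have : 0 < r := (Real.sqrt_nonneg α).trans_lt hr
    positivity
  have hint := integrableOn_Ioi_deriv_of_nonneg' (fun r _ => hderiv r) hnn hlim
  have hval := integral_Ioi_of_hasDerivAt_of_nonneg' (fun r _ => hderiv r) hnn hlim
  rw [Real.sq_sqrt hα] at hval
  have hval' : ∫ r in Set.Ioi √α, r / v * Real.exp (-r ^ 2 / (2 * v)) =
      Real.exp (-α / (2 * v)) := by rw [hval]; ring
  rw [← hval', ofReal_integral_eq_lintegral_ofReal hint
    ((ae_restrict_iff' measurableSet_Ioi).2 (.of_forall hnn)),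
    ← lintegral_indicator measurableSet_Ioi, ← lintegral_indicator measurableSet_Ioi]
  refine lintegral_mono fun r => ?_
  by_cases hr : 0 < r
  · rw [Set.indicator_of_mem (Set.mem_Ioi.2 hr)]
    by_cases h : α < r ^ 2
    · have : √α < r := (Real.sqrt_lt' hr).2 h
      simp [h, this]
    · simp [h]
  · simp [hr]

/-- The variable `s = X² + Y²` has density `exp(-s/2v) / 2v`, which is at most its value at `α` on
the support of `h`. The remaining factor is `∫₀^∞ h = 1 - G 0 ≤ 1`, so the bound does not depend on
how steep the ramp is. -/
theorem lintegral_deriv_sq_add_sq_le (hv : v ≠ 0) (hX : HasLaw X (gaussianReal 0 v) P)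
    (hY : HasLaw Y (gaussianReal 0 v) P) (hXY : IndepFun X Y P) {G h : ℝ → ℝ} {α : ℝ}
    (hG : ∀ s, HasDerivAt G (h s) s) (hh : Continuous h) (hh0 : ∀ s, 0 ≤ h s)
    (hhα : ∀ s < α, h s = 0) (hG0 : 0 ≤ G 0) (hGlim : Filter.Tendsto G Filter.atTop (nhds 1)) :
    ∫⁻ ω, ENNReal.ofReal (h (X ω ^ 2 + Y ω ^ 2)) ∂P ≤
      ENNReal.ofReal (Real.exp (-α / (2 * v)) / (2 * v)) := by
  have hv0 : (0 : ℝ) < v := by positivity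
  rw [lintegral_radial_of_indepFun_gaussian hv hX hY hXY
    (f := fun s => ENNReal.ofReal (h s)) (by fun_prop)]
  have hderiv : ∀ r : ℝ, HasDerivAt (fun r : ℝ => G (r ^ 2)) (h (r ^ 2) * (2 * r)) r := by
    intro r
    have := (hG (r ^ 2)).comp r ((hasDerivAt_id r).pow 2)
    convert! this using 1
    simp
  have hnn : ∀ r ∈ Set.Ioi (0 : ℝ), 0 ≤ h (r ^ 2) * (2 * r) := fun r hr => by
    have hr : 0 < r := hr
    have := hh0 (r ^ 2)
    positivity
  have hlim : Filter.Tendsto (fun r : ℝ => G (r ^ 2)) Filter.atTop (nhds 1) :=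
    hGlim.comp (Filter.tendsto_pow_atTop two_ne_zero)
  have hint := integrableOn_Ioi_deriv_of_nonneg' (fun r _ => hderiv r) hnn hlim
  have hval := integral_Ioi_of_hasDerivAt_of_nonneg' (fun r _ => hderiv r) hnn hlim
  calc ∫⁻ r in Set.Ioi (0 : ℝ),
        ENNReal.ofReal (r / v * Real.exp (-r ^ 2 / (2 * v))) * ENNReal.ofReal (h (r ^ 2))
      ≤ ∫⁻ r in Set.Ioi (0 : ℝ), ENNReal.ofReal (Real.exp (-α / (2 * v)) / (2 * v)) *
          ENNReal.ofReal (h (r ^ 2) * (2 * r)) := by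
        refine setLIntegral_mono' measurableSet_Ioi fun r hr => ?_
        have hr : 0 < r := hr
        rw [← ENNReal.ofReal_mul (by positivity), ← ENNReal.ofReal_mul (by positivity)]
        refine ENNReal.ofReal_le_ofReal ?_
        by_cases hs : r ^ 2 < α
        · simp [hhα _ hs]
        · have he : Real.exp (-r ^ 2 / (2 * v)) ≤ Real.exp (-α / (2 * v)) := by
            gcongr
            exact not_lt.1 hs
          have := hh0 (r ^ 2)
          calc r / v * Real.exp (-r ^ 2 / (2 * v)) * h (r ^ 2)
              ≤ r / v * Real.exp (-α / (2 * v)) * h (r ^ 2) := by gcongr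
            _ = Real.exp (-α / (2 * v)) / (2 * v) * (h (r ^ 2) * (2 * r)) := by
              field_simp
    _ = ENNReal.ofReal (Real.exp (-α / (2 * v)) / (2 * v)) *
          ENNReal.ofReal (1 - G 0) := by
        rw [lintegral_const_mul _ (by fun_prop), ← ofReal_integral_eq_lintegral_ofReal hint
          ((ae_restrict_iff' measurableSet_Ioi).2 (.of_forall hnn)), hval]
        simp
    _ ≤ ENNReal.ofReal (Real.exp (-α / (2 * v)) / (2 * v)) := by
        refine mul_le_of_le_one_right' ?_
        rw [← ENNReal.ofReal_one]
        exact ENNReal.ofReal_le_ofReal (by linarith)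

end Rayleigh

/-- Since `g 0 = g 1`, the value `g t` can be reached from either end of the interval. Averaging the
two estimates halves the total variation. -/
theorem le_add_half_integral_abs_deriv {g g' : ℝ → ℝ} (hg : ∀ t, HasDerivAt g (g' t) t)
    (hc : Continuous g') (h01 : g 0 = g 1) {t : ℝ} (ht : t ∈ Set.Icc (0 : ℝ) 1) :
    g t ≤ g 0 + (∫ s in (0 : ℝ)..1, |g' s|) / 2 := by
  have hi : ∀ a b, IntervalIntegrable g' volume a b := fun a b => hc.intervalIntegrable a b
  have hi' : ∀ a b, IntervalIntegrable (fun s => |g' s|) volume a b :=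
    fun a b => hc.abs.intervalIntegrable a b
  have h1 : ∫ s in (0 : ℝ)..t, g' s = g t - g 0 :=
    intervalIntegral.integral_eq_sub_of_hasDerivAt (fun s _ => hg s) (hi _ _)
  have h2 : ∫ s in t..1, g' s = g 1 - g t :=
    intervalIntegral.integral_eq_sub_of_hasDerivAt (fun s _ => hg s) (hi _ _)
  have h3 := le_of_abs_le
    (intervalIntegral.abs_integral_le_integral_abs (f := g') (μ := volume) ht.1)
  have h4 := neg_le_of_abs_le
    (intervalIntegral.abs_integral_le_integral_abs (f := g') (μ := volume) ht.2)
  have h5 := intervalIntegral.integral_add_adjacent_intervals (hi' 0 t) (hi' t 1)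
  linarith

/-! ### Conditional first moment of the radial derivative -/

section Moments

variable {Ω : Type*} [MeasurableSpace Ω] {P : Measure Ω} [IsProbabilityMeasure P]

/-- This is nonnegativity of the variance of `|f|`. -/
theorem integral_abs_le_sqrt_integral_sq {f : Ω → ℝ} (hf : MemLp f 2 P) :
    ∫ ω, |f ω| ∂P ≤ √(∫ ω, f ω ^ 2 ∂P) := by
  have h := variance_nonneg |f| P
  rw [variance_eq_sub hf.abs] at h
  refine Real.le_sqrt_of_sq_le ?_
  simpa using h

/-- If `(X', Y')` is centred and isotropic with variance `w` and independent of `(X, Y)`, then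
`X X' + Y Y'` has conditional first absolute moment at most `√w √(X² + Y²)` given `(X, Y)`. -/
theorem lintegral_mul_abs_le_of_indepFun {X Y X' Y' : Ω → ℝ} {w : ℝ}
    (hX : AEMeasurable X P) (hY : AEMeasurable Y P)
    (hX' : MemLp X' 2 P) (hY' : MemLp Y' 2 P)
    (hind : IndepFun (fun ω => (X ω, Y ω)) (fun ω => (X' ω, Y' ω)) P)
    (hXX : ∫ ω, X' ω * X' ω ∂P = w) (hYY : ∫ ω, Y' ω * Y' ω ∂P = w)
    (hXY : ∫ ω, X' ω * Y' ω ∂P = 0) {h : ℝ → ℝ} (hh : Continuous h) (hh0 : ∀ s, 0 ≤ h s)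
    {u : ℝ} (hu : 0 ≤ u) (hhu : ∀ s, u ^ 2 < s → h s = 0) :
    ∫⁻ ω, ENNReal.ofReal (h (X ω ^ 2 + Y ω ^ 2) * |X ω * X' ω + Y ω * Y' ω|) ∂P ≤
      ENNReal.ofReal (u * √w) * ∫⁻ ω, ENNReal.ofReal (h (X ω ^ 2 + Y ω ^ 2)) ∂P := by
  have hm : AEMeasurable (fun ω => (X ω, Y ω)) P := hX.prodMk hY
  have hm' : AEMeasurable (fun ω => (X' ω, Y' ω)) P := hX'.aemeasurable.prodMk hY'.aemeasurable
  have hmap := (indepFun_iff_map_prod_eq_prod_map_map hm hm').1 hind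
  have hinner : ∀ x y : ℝ, ∫⁻ ω, ENNReal.ofReal (h (x ^ 2 + y ^ 2) * |x * X' ω + y * Y' ω|) ∂P ≤
      ENNReal.ofReal (u * √w) * ENNReal.ofReal (h (x ^ 2 + y ^ 2)) := by
    intro x y
    -- Above `u²` the factor `h` vanishes; otherwise the radius `√(x² + y²)` is at most `u`.
    by_cases hs : u ^ 2 < x ^ 2 + y ^ 2
    · simp [hhu _ hs]
    have hL : MemLp (fun ω => x * X' ω + y * Y' ω) 2 P := (hX'.const_mul x).add (hY'.const_mul y)
    have hsq : ∫ ω, (x * X' ω + y * Y' ω) ^ 2 ∂P = (x ^ 2 + y ^ 2) * w := by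
      have e : ∀ ω, (x * X' ω + y * Y' ω) ^ 2 = x ^ 2 * (X' ω * X' ω) + y ^ 2 * (Y' ω * Y' ω) +
          2 * x * y * (X' ω * Y' ω) := fun ω => by ring
      simp_rw [e]
      have i1 : Integrable (fun ω => X' ω * X' ω) P := hX'.integrable_mul hX'
      have i2 : Integrable (fun ω => Y' ω * Y' ω) P := hY'.integrable_mul hY'
      have i3 : Integrable (fun ω => X' ω * Y' ω) P := hX'.integrable_mul hY'
      have i4 : Integrable (fun ω => x ^ 2 * (X' ω * X' ω) + y ^ 2 * (Y' ω * Y' ω)) P :=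
        (i1.const_mul _).add (i2.const_mul _)
      rw [integral_add i4 (i3.const_mul _),
        integral_add (i1.const_mul _) (i2.const_mul _), integral_const_mul, integral_const_mul,
        integral_const_mul, hXX, hYY, hXY]
      ring
    have habs : ∫ ω, |x * X' ω + y * Y' ω| ∂P ≤ u * √w := by
      refine (integral_abs_le_sqrt_integral_sq hL).trans ?_
      rw [hsq, Real.sqrt_mul (by positivity)]
      gcongr
      exact Real.sqrt_le_iff.2 ⟨hu, not_lt.1 hs⟩
    simp_rw [ENNReal.ofReal_mul (hh0 _)]
    rw [lintegral_const_mul' _ _ ENNReal.ofReal_ne_top,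
      ← ofReal_integral_eq_lintegral_ofReal (hL.integrable one_le_two).abs
        (.of_forall fun ω => abs_nonneg _), mul_comm]
    gcongr
  have hF : Measurable fun q : (ℝ × ℝ) × (ℝ × ℝ) =>
      ENNReal.ofReal (h (q.1.1 ^ 2 + q.1.2 ^ 2) * |q.1.1 * q.2.1 + q.1.2 * q.2.2|) := by
    fun_prop
  have hH : Measurable fun p : ℝ × ℝ => ENNReal.ofReal (h (p.1 ^ 2 + p.2 ^ 2)) := by fun_prop
  calc ∫⁻ ω, ENNReal.ofReal (h (X ω ^ 2 + Y ω ^ 2) * |X ω * X' ω + Y ω * Y' ω|) ∂P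
      = ∫⁻ q, ENNReal.ofReal (h (q.1.1 ^ 2 + q.1.2 ^ 2) * |q.1.1 * q.2.1 + q.1.2 * q.2.2|)
          ∂(P.map fun ω => ((X ω, Y ω), (X' ω, Y' ω))) :=
        (lintegral_map' hF.aemeasurable (hm.prodMk hm')).symm
    _ = ∫⁻ p, ∫⁻ q, ENNReal.ofReal (h (p.1 ^ 2 + p.2 ^ 2) * |p.1 * q.1 + p.2 * q.2|)
          ∂(P.map fun ω => (X' ω, Y' ω)) ∂(P.map fun ω => (X ω, Y ω)) := by
        rw [hmap, lintegral_prod _ hF.aemeasurable]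
    _ ≤ ∫⁻ p, ENNReal.ofReal (u * √w) * ENNReal.ofReal (h (p.1 ^ 2 + p.2 ^ 2))
          ∂(P.map fun ω => (X ω, Y ω)) := by
        refine lintegral_mono fun p => ?_
        rw [lintegral_map' (by fun_prop) hm']
        exact hinner p.1 p.2
    _ = ENNReal.ofReal (u * √w) * ∫⁻ ω, ENNReal.ofReal (h (X ω ^ 2 + Y ω ^ 2)) ∂P := by
        rw [lintegral_const_mul _ hH, lintegral_map' hH.aemeasurable hm]

end Moments

/-! ### Smooth ramp -/

section Ramp

/-- A `C¹` ramp that vanishes on `(-∞, α]` and equals `1` on `[β, ∞)`. -/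
theorem exists_ramp {α β : ℝ} (hαβ : α < β) : ∃ G h : ℝ → ℝ,
    (∀ s, HasDerivAt G (h s) s) ∧ Continuous h ∧ (∀ s, 0 ≤ h s) ∧ (∀ s, s < α → h s = 0) ∧
    (∀ s, β < s → h s = 0) ∧ (∀ s, 0 ≤ G s) ∧ (∀ s, G s ≤ 1) ∧ (∀ s ≤ α, G s = 0) ∧
    (∀ s, β ≤ s → G s = 1) := by
  have hd : 0 < β - α := sub_pos.2 hαβ
  set G : ℝ → ℝ := fun s => Real.smoothTransition ((s - α) / (β - α)) with hGdef
  have hsm : ContDiff ℝ 1 G := by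
    have h1 : ContDiff ℝ 1 Real.smoothTransition := Real.smoothTransition.contDiff (n := 1)
    exact h1.comp (by fun_prop)
  have hmono : Monotone G := fun a b hab => Real.smoothTransition.monotone (by gcongr)
  have hzero : ∀ s ≤ α, G s = 0 := fun s hs =>
    Real.smoothTransition.zero_of_nonpos (div_nonpos_of_nonpos_of_nonneg (by linarith) hd.le)
  have hone : ∀ s, β ≤ s → G s = 1 := fun s hs =>
    Real.smoothTransition.one_of_one_le ((one_le_div hd).2 (by linarith))
  refine ⟨G, deriv G, fun s => (hsm.differentiable one_ne_zero s).hasDerivAt,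
    hsm.continuous_deriv_one, fun s => hmono.deriv_nonneg, fun s hs => ?_, fun s hs => ?_,
    fun s => Real.smoothTransition.nonneg _, fun s => Real.smoothTransition.le_one _,
    hzero, hone⟩
  · have : G =ᶠ[nhds s] fun _ => 0 := by
      filter_upwards [Iio_mem_nhds hs] with r hr using hzero r (le_of_lt hr)
    rw [this.deriv_eq, deriv_const]
  · have : G =ᶠ[nhds s] fun _ => 1 := by
      filter_upwards [Ioi_mem_nhds hs] with r hr using hone r (le_of_lt hr)
    rw [this.deriv_eq, deriv_const]

end Ramp

/-! ### Power sums over the symmetric frequency range -/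

section FrequencySums

theorem sum_Icc_neg_succ (f : ℤ → ℝ) (n : ℕ) :
    ∑ k ∈ Finset.Icc (-((n + 1 : ℕ) : ℤ)) ((n + 1 : ℕ) : ℤ), f k =
      f (-(n + 1)) + f (n + 1) + ∑ k ∈ Finset.Icc (-(n : ℤ)) (n : ℤ), f k := by
  have h : Finset.Icc (-((n + 1 : ℕ) : ℤ)) ((n + 1 : ℕ) : ℤ) =
      insert (-((n : ℤ) + 1)) (insert ((n : ℤ) + 1) (Finset.Icc (-(n : ℤ)) (n : ℤ))) := by
    ext k
    simp only [Finset.mem_Icc, Finset.mem_insert]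
    omega
  rw [h, Finset.sum_insert, Finset.sum_insert, add_assoc]
  · simp
  · simp only [Finset.mem_Icc, Finset.mem_insert]
    omega

theorem sum_freq_eq (fc : ℕ) (f : ℤ → ℝ) :
    ∑ k : Freq fc, f k = ∑ k ∈ Finset.Icc (-(fc : ℤ)) (fc : ℤ), f k :=
  Finset.sum_coe_sort (Finset.Icc (-(fc : ℤ)) (fc : ℤ)) f

theorem sum_freq_one (fc : ℕ) : ∑ _k : Freq fc, (1 : ℝ) = 2 * fc + 1 := by
  rw [sum_freq_eq fc fun _ => 1]
  induction fc with
  | zero => simp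
  | succ n ih => rw [sum_Icc_neg_succ, ih]; push_cast; ring

theorem sum_freq_id (fc : ℕ) : ∑ k : Freq fc, ((k : ℤ) : ℝ) = 0 := by
  rw [sum_freq_eq fc fun k => (k : ℝ)]
  induction fc with
  | zero => simp
  | succ n ih => rw [sum_Icc_neg_succ, ih]; push_cast; ring

theorem sum_freq_sq (fc : ℕ) :
    ∑ k : Freq fc, ((k : ℤ) : ℝ) ^ 2 = fc * (fc + 1) * (2 * fc + 1) / 3 := by
  rw [sum_freq_eq fc fun k => (k : ℝ) ^ 2]
  induction fc with
  | zero => simp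
  | succ n ih => rw [sum_Icc_neg_succ, ih]; push_cast; ring

end FrequencySums

/-! ### The polynomial and its derivative as linear forms -/

section TrigForms

/-- Coefficients, in the real and imaginary parts of `ε`, of the real and imaginary parts of
`∑ ε_k exp (2 π i k t)` (entries `0` and `1`) and of their `t`-derivatives (entries `2`, `3`). -/
noncomputable def trigCoeff {fc : ℕ} (t : ℝ) : Fin 4 → Freq fc ⊕ Freq fc → ℝ :=
  ![Sum.elim (fun k => Real.cos (2 * Real.pi * (k : ℤ) * t))
      (fun k => -Real.sin (2 * Real.pi * (k : ℤ) * t)),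
    Sum.elim (fun k => Real.sin (2 * Real.pi * (k : ℤ) * t))
      (fun k => Real.cos (2 * Real.pi * (k : ℤ) * t)),
    Sum.elim (fun k => -(2 * Real.pi * (k : ℤ)) * Real.sin (2 * Real.pi * (k : ℤ) * t))
      (fun k => -(2 * Real.pi * (k : ℤ)) * Real.cos (2 * Real.pi * (k : ℤ) * t)),
    Sum.elim (fun k => 2 * Real.pi * (k : ℤ) * Real.cos (2 * Real.pi * (k : ℤ) * t))
      (fun k => -(2 * Real.pi * (k : ℤ)) * Real.sin (2 * Real.pi * (k : ℤ) * t))]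

/-- The linear form with coefficients `trigCoeff t j`. -/
noncomputable def trigForm {fc : ℕ} (w : Freq fc ⊕ Freq fc → ℝ) (j : Fin 4) (t : ℝ) : ℝ :=
  ∑ i, trigCoeff t j i * w i

variable {fc : ℕ}

/-- Four of the six pairs cancel frequency by frequency. The pairs (`0`, `3`) and (`1`, `2`) leave
`±2πk` at each frequency, and these sum to zero by the symmetry `k ↦ -k`. -/
theorem sum_trigCoeff_mul_of_ne (t : ℝ) (j l : Fin 4) (hjl : j ≠ l) :
    ∑ i : Freq fc ⊕ Freq fc, trigCoeff t j i * trigCoeff t l i = 0 := by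
  have hk : ∑ k : Freq fc, 2 * Real.pi * ((k : ℤ) : ℝ) = 0 := by
    rw [← Finset.mul_sum, sum_freq_id, mul_zero]
  have hcs := fun k : Freq fc => Real.sin_sq_add_cos_sq (2 * Real.pi * (k : ℤ) * t)
  wlog h : j < l generalizing j l
  · rw [← this l j hjl.symm (lt_of_le_of_ne (not_lt.1 h) hjl.symm)]
    exact Finset.sum_congr rfl fun i _ => mul_comm _ _
  rw [Fintype.sum_sum_type, ← Finset.sum_add_distrib]
  fin_cases j <;> fin_cases l <;> first | exact absurd h (by decide) | skip
  · refine Finset.sum_eq_zero fun k _ => ?_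
    simp [trigCoeff]; ring
  · refine Finset.sum_eq_zero fun k _ => ?_
    simp [trigCoeff]; ring
  · rw [← hk]
    refine Finset.sum_congr rfl fun k _ => ?_
    simp [trigCoeff]; linear_combination (2 * Real.pi * ((k : ℤ) : ℝ)) * hcs k
  · rw [← neg_zero, ← hk, ← Finset.sum_neg_distrib]
    refine Finset.sum_congr rfl fun k _ => ?_
    simp [trigCoeff]; linear_combination -(2 * Real.pi * ((k : ℤ) : ℝ)) * hcs k
  · refine Finset.sum_eq_zero fun k _ => ?_
    simp [trigCoeff]; ring
  · refine Finset.sum_eq_zero fun k _ => ?_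
    simp [trigCoeff]; ring

theorem sum_trigCoeff_zero_sq (t : ℝ) :
    ∑ i : Freq fc ⊕ Freq fc, trigCoeff t 0 i ^ 2 = 2 * fc + 1 := by
  rw [Fintype.sum_sum_type, ← Finset.sum_add_distrib, ← sum_freq_one]
  refine Finset.sum_congr rfl fun k _ => ?_
  simp [trigCoeff]

theorem sum_trigCoeff_one_sq (t : ℝ) :
    ∑ i : Freq fc ⊕ Freq fc, trigCoeff t 1 i ^ 2 = 2 * fc + 1 := by
  rw [Fintype.sum_sum_type, ← Finset.sum_add_distrib, ← sum_freq_one]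
  refine Finset.sum_congr rfl fun k _ => ?_
  simp [trigCoeff]

theorem sum_trigCoeff_two_sq (t : ℝ) :
    ∑ i : Freq fc ⊕ Freq fc, trigCoeff t 2 i * trigCoeff t 2 i =
      (2 * Real.pi) ^ 2 * (fc * (fc + 1) * (2 * fc + 1) / 3) := by
  rw [Fintype.sum_sum_type, ← Finset.sum_add_distrib, ← sum_freq_sq, Finset.mul_sum]
  refine Finset.sum_congr rfl fun k _ => ?_
  simp [trigCoeff]
  linear_combination (2 * Real.pi * ((k : ℤ) : ℝ)) ^ 2 *
    Real.sin_sq_add_cos_sq (2 * Real.pi * (k : ℤ) * t)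

theorem sum_trigCoeff_three_sq (t : ℝ) :
    ∑ i : Freq fc ⊕ Freq fc, trigCoeff t 3 i * trigCoeff t 3 i =
      (2 * Real.pi) ^ 2 * (fc * (fc + 1) * (2 * fc + 1) / 3) := by
  rw [Fintype.sum_sum_type, ← Finset.sum_add_distrib, ← sum_freq_sq, Finset.mul_sum]
  refine Finset.sum_congr rfl fun k _ => ?_
  simp [trigCoeff]
  linear_combination (2 * Real.pi * ((k : ℤ) : ℝ)) ^ 2 *
    Real.sin_sq_add_cos_sq (2 * Real.pi * (k : ℤ) * t)

theorem continuous_trigCoeff (j : Fin 4) (i : Freq fc ⊕ Freq fc) :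
    Continuous fun t => trigCoeff t j i := by
  fin_cases j <;> rcases i with k | k <;> simp [trigCoeff] <;> fun_prop

theorem continuous_trigForm (j : Fin 4) :
    Continuous fun p : (Freq fc ⊕ Freq fc → ℝ) × ℝ => trigForm p.1 j p.2 :=
  continuous_finsetSum _ fun i _ => ((continuous_trigCoeff j i).comp continuous_snd).mul
    ((continuous_apply i).comp continuous_fst)

theorem continuous_trigForm_right (w : Freq fc ⊕ Freq fc → ℝ) (j : Fin 4) :
    Continuous (trigForm w j) :=
  continuous_finsetSum _ fun i _ => (continuous_trigCoeff j i).mul continuous_const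

theorem hasDerivAt_trigForm_zero (w : Freq fc ⊕ Freq fc → ℝ) (t : ℝ) :
    HasDerivAt (trigForm w 0) (trigForm w 2 t) t := by
  refine HasDerivAt.fun_sum fun i _ => HasDerivAt.mul_const ?_ _
  rcases i with k | k
  · simpa [trigCoeff, mul_comm] using
      ((hasDerivAt_id t).const_mul (2 * Real.pi * ((k : ℤ) : ℝ))).cos
  · simpa [trigCoeff, mul_comm] using
      ((hasDerivAt_id t).const_mul (2 * Real.pi * ((k : ℤ) : ℝ))).sin.fun_neg

theorem hasDerivAt_trigForm_one (w : Freq fc ⊕ Freq fc → ℝ) (t : ℝ) :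
    HasDerivAt (trigForm w 1) (trigForm w 3 t) t := by
  refine HasDerivAt.fun_sum fun i _ => HasDerivAt.mul_const ?_ _
  rcases i with k | k
  · simpa [trigCoeff, mul_comm] using
      ((hasDerivAt_id t).const_mul (2 * Real.pi * ((k : ℤ) : ℝ))).sin
  · simpa [trigCoeff, mul_comm] using
      ((hasDerivAt_id t).const_mul (2 * Real.pi * ((k : ℤ) : ℝ))).cos

theorem trigForm_one_eq_zero (w : Freq fc ⊕ Freq fc → ℝ) (j : Fin 4) :
    trigForm w j 1 = trigForm w j 0 := by
  have hc : ∀ k : ℤ, Real.cos (2 * Real.pi * (k : ℝ)) = 1 := fun k => by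
    rw [mul_comm]; exact Real.cos_int_mul_two_pi k
  have hs : ∀ k : ℤ, Real.sin (2 * Real.pi * (k : ℝ)) = 0 := fun k => by
    have := Real.sin_int_mul_pi (k * 2)
    push_cast at this
    rw [← this]; congr 1; ring
  refine Finset.sum_congr rfl fun i _ => ?_
  fin_cases j <;> rcases i with k | k <;> simp [trigCoeff, hc, hs]

theorem norm_trigPoly_sq (w : Freq fc ⊕ Freq fc → ℝ) (t : ℝ) :
    ‖trigPoly (fun k => (w (.inl k) : ℂ) + Complex.I * (w (.inr k) : ℂ)) t‖ ^ 2 =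
      trigForm w 0 t ^ 2 + trigForm w 1 t ^ 2 := by
  have hz : trigPoly (fun k => (w (.inl k) : ℂ) + Complex.I * (w (.inr k) : ℂ)) t =
      ((trigForm w 0 t : ℝ) : ℂ) + (trigForm w 1 t : ℝ) * Complex.I := by
    simp only [trigPoly, trigForm, Fintype.sum_sum_type, Complex.ofReal_add, Complex.ofReal_sum,
      ← Finset.sum_add_distrib, add_mul, Finset.sum_mul]
    refine Finset.sum_congr rfl fun k _ => ?_
    have he : trigFun (k : ℤ) t = (Real.cos (2 * Real.pi * (k : ℤ) * t) : ℝ) +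
        (Real.sin (2 * Real.pi * (k : ℤ) * t) : ℝ) * Complex.I := by
      rw [trigFun, Complex.ofReal_cos, Complex.ofReal_sin, ← Complex.exp_mul_I]
      congr 1
      push_cast
      ring
    rw [he]
    simp only [trigCoeff, Matrix.cons_val_zero, Matrix.cons_val_one, Sum.elim_inl, Sum.elim_inr,
      Complex.ofReal_mul, Complex.ofReal_neg]
    ring_nf
    simp only [Complex.I_sq]
    ring
  rw [hz, Complex.sq_norm, Complex.normSq_add_mul_I]

end TrigForms

/-! ### The tail estimate -/

section Tail

/-- A trigonometric polynomial whose modulus exceeds `u` somewhere forces a ramp functional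
of its squared modulus to be at least `1`. -/
theorem one_le_ramp_add_integral {fc : ℕ} (w : Freq fc ⊕ Freq fc → ℝ) {u : ℝ} (hu : 0 ≤ u)
    {G h : ℝ → ℝ} (hG : ∀ s, HasDerivAt G (h s) s) (hh : Continuous h) (hh0 : ∀ s, 0 ≤ h s)
    (hG1 : ∀ s, u ^ 2 ≤ s → G s = 1)
    {t : ℝ} (ht : t ∈ Set.Icc (0 : ℝ) 1)
    (hut : u < ‖trigPoly (fun k => (w (.inl k) : ℂ) + Complex.I * (w (.inr k) : ℂ)) t‖) :
    1 ≤ G (trigForm w 0 0 ^ 2 + trigForm w 1 0 ^ 2) +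
      ∫ t in (0 : ℝ)..1, h (trigForm w 0 t ^ 2 + trigForm w 1 t ^ 2) *
        |trigForm w 0 t * trigForm w 2 t + trigForm w 1 t * trigForm w 3 t| := by
  have hS : u ^ 2 ≤ trigForm w 0 t ^ 2 + trigForm w 1 t ^ 2 := by
    rw [← norm_trigPoly_sq]
    gcongr
  have hd : ∀ s, HasDerivAt (fun s => G (trigForm w 0 s ^ 2 + trigForm w 1 s ^ 2))
      (h (trigForm w 0 s ^ 2 + trigForm w 1 s ^ 2) *
        (2 * (trigForm w 0 s * trigForm w 2 s + trigForm w 1 s * trigForm w 3 s))) s := by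
    intro s
    have hS' : HasDerivAt (fun s => trigForm w 0 s ^ 2 + trigForm w 1 s ^ 2)
        (2 * (trigForm w 0 s * trigForm w 2 s + trigForm w 1 s * trigForm w 3 s)) s := by
      refine (((hasDerivAt_trigForm_zero w s).fun_pow 2).fun_add
        ((hasDerivAt_trigForm_one w s).fun_pow 2)).congr_deriv ?_
      ring
    exact (hG _).comp s hS'
  have hc0 := continuous_trigForm_right w 0
  have hc1 := continuous_trigForm_right w 1
  have hc2 := continuous_trigForm_right w 2
  have hc3 := continuous_trigForm_right w 3
  have key := le_add_half_integral_abs_deriv hd (by fun_prop)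
    (by simp only [trigForm_one_eq_zero]) ht
  rw [hG1 _ hS] at key
  refine key.trans_eq ?_
  -- The factor `2` from differentiating the squares cancels the half in front of the variation.
  rw [← intervalIntegral.integral_div]
  congr 2
  ext s
  rw [abs_mul, abs_of_nonneg (hh0 _), abs_mul, abs_two]
  ring

/-- In the second term, half of the decay `exp(-x²/2)` is spent on absorbing the linear factor `π
x`. -/
theorem exp_mul_one_add_le {x c : ℝ} (hc : 0 ≤ c) :
    Real.exp (1 / 4 - x ^ 2 / 2) * (1 + Real.pi * x * c) ≤
      4 * (Real.exp (-x ^ 2 / 2) + c * Real.exp (-x ^ 2 / 4)) := by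
  have h1 : Real.exp (1 / 4 - x ^ 2 / 2) ≤ 4 * Real.exp (-x ^ 2 / 2) := by
    have : Real.exp (1 / 4) ≤ 4 := by
      have := Real.exp_le_exp.2 (show (1 / 4 : ℝ) ≤ 1 by norm_num)
      linarith [Real.exp_one_lt_d9]
    calc Real.exp (1 / 4 - x ^ 2 / 2) = Real.exp (1 / 4) * Real.exp (-x ^ 2 / 2) := by
          rw [← Real.exp_add]; ring_nf
      _ ≤ _ := by gcongr
  have h2 : Real.exp (1 / 4 - x ^ 2 / 2) * (Real.pi * x) ≤ 4 * Real.exp (-x ^ 2 / 4) := by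
    -- Complete the square and use `π²/4 < 3`. The constant `3` makes the right side `4 ((x² - 1)/4
    -- + 1)`, ready for `y + 1 ≤ exp y`.
    have ha : Real.pi * x ≤ x ^ 2 + 3 := by
      nlinarith [sq_nonneg (x - Real.pi / 2), Real.pi_lt_d2, Real.pi_pos]
    have hb := Real.add_one_le_exp ((x ^ 2 - 1) / 4)
    calc Real.exp (1 / 4 - x ^ 2 / 2) * (Real.pi * x)
        ≤ Real.exp (1 / 4 - x ^ 2 / 2) * (4 * Real.exp ((x ^ 2 - 1) / 4)) := by
          refine mul_le_mul_of_nonneg_left ?_ (Real.exp_pos _).le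
          linarith
      _ = 4 * Real.exp (-x ^ 2 / 4) := by
          rw [mul_left_comm, ← Real.exp_add]; ring_nf
  nlinarith [mul_le_mul_of_nonneg_right h2 hc]

variable {Ω : Type*} [MeasurableSpace Ω] {P : Measure Ω} [IsProbabilityMeasure P] {fc : ℕ}
  {W : Freq fc ⊕ Freq fc → Ω → ℝ}

theorem measureReal_lt_iSup_norm_trigPoly_le (hW : ∀ i, HasLaw (W i) (gaussianReal 0 1) P)
    (hind : iIndepFun W P) {u α : ℝ} (hu : 0 ≤ u) (hα : 0 ≤ α) (hαu : α < u ^ 2) :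
    P.real {ω | u < ⨆ t : Set.Icc (0 : ℝ) 1,
      ‖trigPoly (fun k => (W (.inl k) ω : ℂ) + Complex.I * (W (.inr k) ω : ℂ)) (t : ℝ)‖} ≤
      Real.exp (-α / (2 * (2 * fc + 1))) + u * √((2 * Real.pi) ^ 2 *
        (fc * (fc + 1) * (2 * fc + 1) / 3)) *
          (Real.exp (-α / (2 * (2 * fc + 1))) / (2 * (2 * fc + 1))) := by
  obtain ⟨G, h, hG, hh, hh0, hhα, hhu, hG0, hG1, hGα, hGu⟩ := exists_ramp hαu
  set v : ℝ≥0 := (2 * (fc : ℝ) + 1).toNNReal with hv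
  have hvr : (v : ℝ) = 2 * fc + 1 := Real.coe_toNNReal _ (by positivity)
  have hv0 : v ≠ 0 := by
    rw [← NNReal.coe_ne_zero, hvr]
    positivity
  rw [← hvr]
  set q : ℝ := (2 * Real.pi) ^ 2 * (fc * (fc + 1) * v / 3) with hq
  set A : Fin 4 → ℝ → Ω → ℝ := fun j t ω => trigForm (W · ω) j t with hA
  have hWm : AEMeasurable (fun ω => (W · ω)) P :=
    aemeasurable_pi_lambda _ fun i => (hW i).aemeasurable
  have hAind : ∀ t, iIndepFun (fun j => A j t) P := fun t =>
    iIndepFun_linearForms hW hind (trigCoeff t) (sum_trigCoeff_mul_of_ne t)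
  have hA2 : ∀ j t, MemLp (A j t) 2 P := fun j t => memLp_two_linearForm hW _
  have hAm : ∀ j t, AEMeasurable (A j t) P := fun j t => (hA2 j t).aemeasurable
  have hX : ∀ t, HasLaw (A 0 t) (gaussianReal 0 v) P := fun t => ⟨hAm 0 t, by
    rw [hv, ← sum_trigCoeff_zero_sq t]
    exact map_linearForm_eq_gaussianReal hW hind _⟩
  have hY : ∀ t, HasLaw (A 1 t) (gaussianReal 0 v) P := fun t => ⟨hAm 1 t, by
    rw [hv, ← sum_trigCoeff_one_sq t]
    exact map_linearForm_eq_gaussianReal hW hind _⟩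
  have hXY : ∀ t, IndepFun (A 0 t) (A 1 t) P := fun t => (hAind t).indepFun (by decide)
  -- The ramp is dominated by the indicator of `(α, ∞)`.
  have hstart : ∫⁻ ω, ENNReal.ofReal (G (A 0 0 ω ^ 2 + A 1 0 ω ^ 2)) ∂P ≤
      ENNReal.ofReal (Real.exp (-α / (2 * v))) := by
    refine le_trans (lintegral_mono fun ω => ?_)
      (lintegral_indicator_sq_add_sq_le hv0 (hX 0) (hY 0) (hXY 0) hα)
    by_cases hs : α < A 0 0 ω ^ 2 + A 1 0 ω ^ 2
    · simpa [hs] using hG1 _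
    · simp [hGα _ (not_lt.1 hs)]
  have hrate : ∀ t, ∫⁻ ω, ENNReal.ofReal (h (A 0 t ω ^ 2 + A 1 t ω ^ 2) *
      |A 0 t ω * A 2 t ω + A 1 t ω * A 3 t ω|) ∂P ≤
      ENNReal.ofReal (u * √q) * ENNReal.ofReal (Real.exp (-α / (2 * v)) / (2 * v)) := by
    intro t
    have hlim : Filter.Tendsto G Filter.atTop (nhds 1) :=
      tendsto_const_nhds.congr' <| by
        filter_upwards [Filter.eventually_ge_atTop (u ^ 2)] with s hs using (hGu s hs).symm
    refine (lintegral_mul_abs_le_of_indepFun (hAm 0 t) (hAm 1 t) (hA2 2 t) (hA2 3 t)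
      ((hAind t).indepFun_prodMk_prodMk₀ (hAm · t) 0 1 2 3 (by decide) (by decide) (by decide)
        (by decide)) ?_ ?_ ?_ hh hh0 hu hhu).trans
      (mul_le_mul_right (lintegral_deriv_sq_add_sq_le hv0 (hX t) (hY t) (hXY t) hG hh hh0 hhα
        (hG0 0) hlim) _)
    · rw [hq, hvr, ← sum_trigCoeff_two_sq t]
      exact integral_linearForm_mul hW hind _ _
    · rw [hq, hvr, ← sum_trigCoeff_three_sq t]
      exact integral_linearForm_mul hW hind _ _
    · rw [← sum_trigCoeff_mul_of_ne (fc := fc) t 2 3 (by decide)]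
      exact integral_linearForm_mul hW hind _ _
  set F : (Freq fc ⊕ Freq fc → ℝ) × ℝ → ℝ := fun p =>
    h (trigForm p.1 0 p.2 ^ 2 + trigForm p.1 1 p.2 ^ 2) *
      |trigForm p.1 0 p.2 * trigForm p.1 2 p.2 + trigForm p.1 1 p.2 * trigForm p.1 3 p.2| with hF
  have hFc : Continuous F := by
    have h0 := continuous_trigForm (fc := fc) 0
    have h1 := continuous_trigForm (fc := fc) 1
    have h2 := continuous_trigForm (fc := fc) 2
    have h3 := continuous_trigForm (fc := fc) 3
    fun_prop
  have hF0 : ∀ p, 0 ≤ F p := fun p => mul_nonneg (hh0 _) (abs_nonneg _)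
  have hswap : ∫⁻ ω, (∫⁻ t in Set.Ioc (0 : ℝ) 1, ENNReal.ofReal (F ((W · ω), t))) ∂P =
      ∫⁻ t in Set.Ioc (0 : ℝ) 1, (∫⁻ ω, ENNReal.ofReal (F ((W · ω), t)) ∂P) := by
    refine lintegral_lintegral_swap ?_
    exact (hFc.measurable.ennreal_ofReal).comp_aemeasurable
      (hWm.comp_fst.prodMk measurable_snd.aemeasurable)
  have hinner : ∀ ω, ENNReal.ofReal (∫ t in (0 : ℝ)..1, F ((W · ω), t)) =
      ∫⁻ t in Set.Ioc (0 : ℝ) 1, ENNReal.ofReal (F ((W · ω), t)) := by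
    intro ω
    rw [intervalIntegral.integral_of_le zero_le_one, ofReal_integral_eq_lintegral_ofReal]
    · have hc : Continuous fun t => F ((W · ω), t) := by fun_prop
      exact (hc.intervalIntegrable 0 1).1
    · exact .of_forall fun t => hF0 _
  have hmain : P {ω | u < ⨆ t : Set.Icc (0 : ℝ) 1,
      ‖trigPoly (fun k => (W (.inl k) ω : ℂ) + Complex.I * (W (.inr k) ω : ℂ)) (t : ℝ)‖} ≤
      ENNReal.ofReal (Real.exp (-α / (2 * v)) +
        u * √q * (Real.exp (-α / (2 * v)) / (2 * v))) := by
    have hGm : Measurable G :=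
      (continuous_iff_continuousAt.2 fun s => (hG s).continuousAt).measurable
    have hGA : AEMeasurable (fun ω => ENNReal.ofReal (G (A 0 0 ω ^ 2 + A 1 0 ω ^ 2))) P :=
      (hGm.comp_aemeasurable (((hAm 0 0).pow_const 2).add ((hAm 1 0).pow_const 2))).ennreal_ofReal
    calc P {ω | u < ⨆ t : Set.Icc (0 : ℝ) 1,
        ‖trigPoly (fun k => (W (.inl k) ω : ℂ) + Complex.I * (W (.inr k) ω : ℂ)) (t : ℝ)‖}
        ≤ ∫⁻ ω, ENNReal.ofReal (G (A 0 0 ω ^ 2 + A 1 0 ω ^ 2)) +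
            (∫⁻ t in Set.Ioc (0 : ℝ) 1, ENNReal.ofReal (F ((W · ω), t))) ∂P := by
          -- Markov's inequality at level `1`.
          refine (measure_mono fun ω hω => ?_).trans
            (meas_le_lintegral₀ (s := {ω | 1 ≤ ENNReal.ofReal (G (A 0 0 ω ^ 2 + A 1 0 ω ^ 2)) +
              ∫⁻ t in Set.Ioc (0 : ℝ) 1, ENNReal.ofReal (F ((W · ω), t))}) ?_ fun ω hω => hω)
          -- A single `t` with modulus above `u` suffices, so the supremum need not be attained.
          · obtain ⟨t, ht⟩ := exists_lt_of_lt_ciSup (Set.mem_ofPred_eq ▸ hω)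
            have := one_le_ramp_add_integral (W · ω) hu hG hh hh0 hGu t.2 ht
            have := ENNReal.ofReal_le_ofReal this
            rw [ENNReal.ofReal_one, ENNReal.ofReal_add (hG0 _)
              (intervalIntegral.integral_nonneg zero_le_one fun t _ => hF0 ((W · ω), t)),
              hinner] at this
            exact this
          · refine hGA.add ?_
            exact (AEMeasurable.lintegral_prod_right' (ν := volume.restrict (Set.Ioc (0 : ℝ) 1))
              ((hFc.measurable.ennreal_ofReal).comp_aemeasurable
                (hWm.comp_fst.prodMk measurable_snd.aemeasurable)))
      _ ≤ ENNReal.ofReal (Real.exp (-α / (2 * v))) + ∫⁻ t in Set.Ioc (0 : ℝ) 1,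
            ENNReal.ofReal (u * √q) * ENNReal.ofReal (Real.exp (-α / (2 * v)) / (2 * v)) := by
          rw [lintegral_add_left' hGA, hswap]
          exact add_le_add hstart (lintegral_mono fun t => hrate t)
      _ = _ := by
          rw [setLIntegral_const, Real.volume_Ioc, sub_zero, ENNReal.ofReal_one, mul_one,
            ← ENNReal.ofReal_mul (by positivity), ← ENNReal.ofReal_add (by positivity)
            (by positivity)]
  exact ENNReal.toReal_le_of_le_ofReal (by positivity) hmain

end Tail

/-! ### Choice of the lower threshold and conclusion -/

theorem mainTheorem5 {Ω : Type*} [MeasurableSpace Ω]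
    (P : MeasureTheory.Measure Ω) [MeasureTheory.IsProbabilityMeasure P]
    (fc : ℕ) (ε₁ ε₂ : Freq fc → Ω → ℝ)
    (hε₁ : ∀ k, ProbabilityTheory.HasLaw (ε₁ k) (ProbabilityTheory.gaussianReal 0 1) P)
    (hε₂ : ∀ k, ProbabilityTheory.HasLaw (ε₂ k) (ProbabilityTheory.gaussianReal 0 1) P)
    (hindep : ProbabilityTheory.iIndepFun (Sum.elim ε₁ ε₂) P)
    (ε : Freq fc → Ω → ℂ)
    (hε : ∀ k ω, ε k ω = (ε₁ k ω : ℂ) + Complex.I * (ε₂ k ω : ℂ))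
    (u : ℝ) (hu : √2 < u) :
    P.real {ω | u < ⨆ t : Set.Icc (0 : ℝ) 1, ‖trigPoly (fun k => ε k ω) (t : ℝ)‖} ≤
      4 * (Real.exp (-u ^ 2 / (2 * (2 * (fc : ℝ) + 1))) +
        √((fc : ℝ) * ((fc : ℝ) + 1) / 3) *
          Real.exp (-u ^ 2 / (4 * (2 * (fc : ℝ) + 1)))) := by
  have hu0 : 0 ≤ u := (Real.sqrt_nonneg 2).trans hu.le
  set N : ℝ := 2 * (fc : ℝ) + 1 with hN
  have hN0 : 0 < N := by positivity
  set c : ℝ := √((fc : ℝ) * ((fc : ℝ) + 1) / 3) with hc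
  rcases lt_or_ge (u ^ 2) N with huN | huN
  · refine measureReal_le_one.trans ?_
    -- Here the first term alone is at least `4 (1 - 1/2) = 2`, so the bound is trivial.
    have h1 : -1 / 2 ≤ -u ^ 2 / (2 * N) := by
      rw [div_le_div_iff₀ (by norm_num) (by positivity)]
      linarith
    have h2 := Real.add_one_le_exp (-u ^ 2 / (2 * N))
    have h3 : 0 ≤ c * Real.exp (-u ^ 2 / (4 * N)) := by positivity
    linarith
  · have hW : ∀ i, HasLaw (Sum.elim ε₁ ε₂ i) (gaussianReal 0 1) P := by
      rintro (k | k)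
      · exact hε₁ k
      · exact hε₂ k
    -- A ramp of width `N/2` keeps `α` nonnegative because `N ≤ u²`, and costs only a factor
    -- `exp(1/4)`, which the constant `4` absorbs.
    have key := measureReal_lt_iSup_norm_trigPoly_le hW hindep hu0 (α := u ^ 2 - N / 2)
      (by linarith) (by linarith)
    simp only [Sum.elim_inl, Sum.elim_inr, ← hε, ← hN] at key
    refine key.trans ?_
    have hx2 : (u / √N) ^ 2 = u ^ 2 / N := by rw [div_pow, Real.sq_sqrt hN0.le]
    have hsqrt : √((2 * Real.pi) ^ 2 * (fc * (fc + 1) * N / 3)) = 2 * Real.pi * (√N * c) := by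
      rw [Real.sqrt_mul (by positivity), Real.sqrt_sq (by positivity), hc,
        ← Real.sqrt_mul hN0.le]
      congr 2
      ring
    have hnum := exp_mul_one_add_le (x := u / √N) (Real.sqrt_nonneg _ : 0 ≤ c)
    have e1 : -(u ^ 2 - N / 2) / (2 * N) = 1 / 4 - (u / √N) ^ 2 / 2 := by
      rw [hx2]; field_simp; ring
    have e2 : -(u / √N) ^ 2 / 2 = -u ^ 2 / (2 * N) := by rw [hx2]; field_simp
    have e3 : -(u / √N) ^ 2 / 4 = -u ^ 2 / (4 * N) := by rw [hx2]; field_simp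
    have e4 : u * (2 * Real.pi * (√N * c)) / (2 * N) = Real.pi * (u / √N) * c := by
      have hs : √N * √N = N := Real.mul_self_sqrt hN0.le
      have hs0 : 0 < √N := Real.sqrt_pos.2 hN0
      rw [div_eq_iff (by positivity)]
      field_simp
      linear_combination (u * c) * hs
    rw [e2, e3] at hnum
    rw [hsqrt, e1]
    refine le_trans (le_of_eq ?_) hnum
    rw [← e4]
    ring
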